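/- Let $\mathfrak P$ be the free abelian group on the combinatorial equivalence classes of (nonempty) convex polytopes, made into a commutative ring by the product of polytopes; its unit is the class of a point. For a polytope $P$ put $F_P(t)=\sum_f f\,t^{\operatorname{codim} f}\in\mathfrak P[t]$, the sum being over all nonempty faces $f$ of $P$ ($P$ included). For $n\ge 1$ let $\pi_n$ be the permutohedron, the convex hull in $\mathbb R^n$ of the points $(\sigma(1),\dots,\sigma(n))$, $\sigma\in S_n$, and let its weighted motivic interior be $$\pi_n^\circ:=F_{\pi_n}(-\pi_1)=\sum_f(-\pi_1)^{\operatorname{codim} f}f .$$ Then the power series $$P(x)=1+\sum_{n\ge1}\pi_n\frac{x^n}{n!},\qquad P^\circ(x)=1-\sum_{n\ge1}\pi_n^\circ\frac{x^n}{n!}$$ are multiplicatively inverse to each other: $P(x)P^\circ(x)=1$ in $(\mathfrak P\otimes\mathbb Q)[[x]]$. This holds both in $\mathfrak P$ itself, where the point $\pi_1$ is the unit, and when $\pi_1$ is kept as an independent variable, in the following sense. Work in $\mathfrak P[w,w^{-1}]$ with $w$ in place of $\pi_1$. Every face of $\pi_n$ of codimension $m-1$ is a product $\pi_{k_1}\times\cdots\times\pi_{k_m}$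 with $k_1+\dots+k_m=n$, and the factors $\pi_1$ in it correspond to the coordinates that are constant on the face. In $F_{\pi_n}(t)$ such a face is recorded as $w^{1-m}\pi_{k_1}\cdots\pi_{k_m}$ with every factor $\pi_1$ replaced by $w$ (the point being the unit for $\times$), and $\pi_n^\circ$ is obtained by putting $t=-w$, so that, for example, $\pi_3^\circ=\pi_3-6w\pi_2+6w^3$ and $\pi_4^\circ=\pi_4-8w\pi_3-6\pi_2^2+36w^2\pi_2-24w^4$. -/

import Mathlib

open scoped TensorProduct Nat LaurentPolynomial

noncomputable section

namespace Polytopal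

/-- A (nonempty) convex polytope in `ℝ^d`: the convex hull of a finite nonempty set of points. -/
structure Polytope (d : ℕ) where
  carrier : Set (Fin d → ℝ)
  isPolytope : ∃ s : Finset (Fin d → ℝ), s.Nonempty ∧ carrier = convexHull ℝ (s : Set (Fin d → ℝ))

/-- The nonempty faces of a polytope, the polytope itself included: the sets of points where a
linear functional attains its maximum on the polytope. -/
@[ext]
structure Face {d : ℕ} (P : Polytope d) where
  carrier : Set (Fin d → ℝ)
  nonempty : carrier.Nonempty
  isExposed : IsExposed ℝ P.carrier carrier

/-- Faces are ordered by inclusion. This poset is the face lattice without its bottom element, the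
empty face. -/
instance {d : ℕ} (P : Polytope d) : PartialOrder (Face P) :=
  PartialOrder.lift Face.carrier (fun _ _ h => Face.ext h)

theorem Face.le_iff {d : ℕ} {P : Polytope d} (F G : Face P) : F ≤ G ↔ F.carrier ⊆ G.carrier :=
  Iff.rfl

/-- Two polytopes, possibly in spaces of different dimensions, are combinatorially equivalent if
their face posets are isomorphic. -/
instance combSetoid : Setoid (Σ d, Polytope d) where
  r P Q := Nonempty (Face P.2 ≃o Face Q.2)
  iseqv :=
    ⟨fun _ => ⟨OrderIso.refl _⟩, fun ⟨e⟩ => ⟨e.symm⟩, fun ⟨e⟩ ⟨f⟩ => ⟨e.trans f⟩⟩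

/-! Faces of a polytope are polytopes, and there are finitely many of them. -/

theorem Polytope.face_eq_convexHull {d : ℕ} (P : Polytope d) (s : Finset (Fin d → ℝ))
    (hs : P.carrier = convexHull ℝ (s : Set (Fin d → ℝ))) (F : Face P) :
    F.carrier = convexHull ℝ ((s : Set (Fin d → ℝ)) ∩ F.carrier) := by
  have hP : IsCompact P.carrier := by rw [hs]; exact s.finite_toSet.isCompact_convexHull ℝ
  have hPc : Convex ℝ P.carrier := by rw [hs]; exact convex_convexHull ℝ _
  have hF := F.isExposed
  have hFc : Convex ℝ F.carrier := hF.convex hPc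
  have hext : F.carrier.extremePoints ℝ ⊆ (s : Set (Fin d → ℝ)) ∩ F.carrier := by
    intro x hx
    refine ⟨?_, extremePoints_subset hx⟩
    have h1 := hF.isExtreme.extremePoints_subset_extremePoints hx
    rw [hs] at h1
    exact extremePoints_convexHull_subset h1
  apply Set.Subset.antisymm
  · have hkm := closure_convexHull_extremePoints (hF.isCompact hP) hFc
    have hfin : ((s : Set (Fin d → ℝ)) ∩ F.carrier).Finite := s.finite_toSet.inter_of_left _
    calc F.carrier = closure (convexHull ℝ (F.carrier.extremePoints ℝ)) := hkm.symm
      _ ⊆ closure (convexHull ℝ ((s : Set (Fin d → ℝ)) ∩ F.carrier)) :=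
          closure_mono (convexHull_mono hext)
      _ = convexHull ℝ ((s : Set (Fin d → ℝ)) ∩ F.carrier) :=
          (hfin.isClosed_convexHull ℝ).closure_eq
  · exact convexHull_min Set.inter_subset_right hFc

instance {d : ℕ} (P : Polytope d) : Finite (Face P) := by
  obtain ⟨s, -, hs⟩ := P.isPolytope
  have : Finite (Set.powerset (s : Set (Fin d → ℝ))) := s.finite_toSet.finite_subsets
  refine Finite.of_injective
    (fun F : Face P => (⟨(s : Set (Fin d → ℝ)) ∩ F.carrier, Set.inter_subset_left⟩ :
      Set.powerset (s : Set (Fin d → ℝ)))) ?_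
  intro F G h
  have h' : (s : Set (Fin d → ℝ)) ∩ F.carrier = (s : Set (Fin d → ℝ)) ∩ G.carrier :=
    congrArg Subtype.val h
  apply Face.ext
  rw [P.face_eq_convexHull s hs F, P.face_eq_convexHull s hs G, h']

instance {d : ℕ} (P : Polytope d) : Fintype (Face P) := Fintype.ofFinite _

/-- A face, as a polytope. -/
def Face.toPolytope {d : ℕ} {P : Polytope d} (F : Face P) : Polytope d where
  carrier := F.carrier
  isPolytope := by
    classical
    obtain ⟨s, -, hs⟩ := P.isPolytope
    have hF := P.face_eq_convexHull s hs F
    have hfin : ((s : Set (Fin d → ℝ)) ∩ F.carrier).Finite := s.finite_toSet.inter_of_left _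
    refine ⟨hfin.toFinset, ?_, by rw [hfin.coe_toFinset]; exact hF⟩
    rw [Set.Finite.toFinset_nonempty, ← convexHull_nonempty_iff (𝕜 := ℝ), ← hF]
    exact F.nonempty

/-- The dimension of a polytope, i.e. of its affine span. -/
def Polytope.dim {d : ℕ} (P : Polytope d) : ℕ := Module.finrank ℝ (vectorSpan ℝ P.carrier)

/-- The codimension of a face. -/
def Face.codim {d : ℕ} {P : Polytope d} (F : Face P) : ℕ := P.dim - F.toPolytope.dim

/-! ### Products -/

/-- The identification `ℝ^d × ℝ^e = ℝ^(d+e)`. -/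
def appendEquiv (d e : ℕ) : ((Fin d → ℝ) × (Fin e → ℝ)) ≃ₗ[ℝ] (Fin (d + e) → ℝ) where
  toEquiv := Fin.appendEquiv d e
  map_add' x y := by
    ext i
    refine Fin.addCases (fun i => ?_) (fun i => ?_) i <;> simp [Fin.appendEquiv]
  map_smul' c x := by
    ext i
    refine Fin.addCases (fun i => ?_) (fun i => ?_) i <;> simp [Fin.appendEquiv]

/-- The product of two polytopes. -/
def Polytope.prod {d e : ℕ} (P : Polytope d) (Q : Polytope e) : Polytope (d + e) where
  carrier := appendEquiv d e '' (P.carrier ×ˢ Q.carrier)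
  isPolytope := by
    classical
    obtain ⟨s, hs0, hs⟩ := P.isPolytope
    obtain ⟨t, ht0, ht⟩ := Q.isPolytope
    refine ⟨(s ×ˢ t).image (appendEquiv d e), (hs0.product ht0).image _, ?_⟩
    rw [Finset.coe_image, Finset.coe_product, hs, ht, ← convexHull_prod]
    exact (appendEquiv d e).toLinearMap.image_convexHull _

/-- The point, the polytope in `ℝ^0`. -/
def Polytope.point : Polytope 0 where
  carrier := Set.univ
  isPolytope := ⟨{0}, by simp, by
    ext x
    simp [Subsingleton.elim x 0]⟩

theorem isExposed_prod_iff {d e : ℕ} (A : Set (Fin d → ℝ)) (B : Set (Fin e → ℝ))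
    (G : Set (Fin (d + e) → ℝ)) :
    (G.Nonempty ∧ IsExposed ℝ (appendEquiv d e '' (A ×ˢ B)) G) ↔
      ∃ F₁ F₂, (F₁.Nonempty ∧ IsExposed ℝ A F₁) ∧ (F₂.Nonempty ∧ IsExposed ℝ B F₂) ∧
        G = appendEquiv d e '' (F₁ ×ˢ F₂) := by
  constructor
  · rintro ⟨hG, hGe⟩
    obtain ⟨l, hl⟩ := hGe hG
    let m : ((Fin d → ℝ) × (Fin e → ℝ)) →L[ℝ] ℝ :=
      l.comp ((appendEquiv d e).toLinearMap.toContinuousLinearMap)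
    have hm : ∀ x y, l (appendEquiv d e (x, y)) = m (x, 0) + m (0, y) := by
      intro x y
      rw [← map_add]
      simp [m]
    let l₁ : (Fin d → ℝ) →L[ℝ] ℝ := m.comp (ContinuousLinearMap.inl ℝ _ _)
    let l₂ : (Fin e → ℝ) →L[ℝ] ℝ := m.comp (ContinuousLinearMap.inr ℝ _ _)
    have hm' : ∀ x y, l (appendEquiv d e (x, y)) = l₁ x + l₂ y := hm
    have key : G = appendEquiv d e '' (l₁.toExposed A ×ˢ l₂.toExposed B) := by
      rw [hl]
      ext z
      constructor
      · rintro ⟨⟨⟨x, y⟩, ⟨hx, hy⟩, rfl⟩, hz⟩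
        simp only at hx hy
        refine ⟨(x, y), ⟨⟨hx, fun x' hx' => ?_⟩, ⟨hy, fun y' hy' => ?_⟩⟩, rfl⟩
        · have := hz _ ⟨(x', y), ⟨hx', hy⟩, rfl⟩
          rw [hm', hm'] at this
          linarith
        · have := hz _ ⟨(x, y'), ⟨hx, hy'⟩, rfl⟩
          rw [hm', hm'] at this
          linarith
      · rintro ⟨⟨x, y⟩, ⟨hx, hy⟩, rfl⟩
        refine ⟨⟨(x, y), ⟨hx.1, hy.1⟩, rfl⟩, ?_⟩
        rintro _ ⟨⟨x', y'⟩, ⟨hx', hy'⟩, rfl⟩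
        rw [hm', hm']
        exact add_le_add (hx.2 _ hx') (hy.2 _ hy')
    have hne : (l₁.toExposed A ×ˢ l₂.toExposed B).Nonempty := by
      rw [key] at hG
      exact hG.of_image
    exact ⟨_, _, ⟨hne.fst, ContinuousLinearMap.toExposed.isExposed⟩,
      ⟨hne.snd, ContinuousLinearMap.toExposed.isExposed⟩, key⟩
  · rintro ⟨F₁, F₂, ⟨h₁, e₁⟩, ⟨h₂, e₂⟩, rfl⟩
    refine ⟨(h₁.prod h₂).image _, fun _ => ?_⟩
    obtain ⟨l₁, hl₁⟩ := e₁ h₁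
    obtain ⟨l₂, hl₂⟩ := e₂ h₂
    let m : ((Fin d → ℝ) × (Fin e → ℝ)) →L[ℝ] ℝ := l₁.coprod l₂
    let l : (Fin (d + e) → ℝ) →L[ℝ] ℝ :=
      m.comp ((appendEquiv d e).symm.toLinearMap.toContinuousLinearMap)
    have hm' : ∀ x y, l (appendEquiv d e (x, y)) = l₁ x + l₂ y := by
      intro x y
      simp [l, m]
    refine ⟨l, ?_⟩
    obtain ⟨a, ha⟩ := h₁
    obtain ⟨b, hb⟩ := h₂
    rw [hl₁] at ha
    rw [hl₂] at hb
    rw [hl₁, hl₂]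
    ext z
    constructor
    · rintro ⟨⟨x, y⟩, ⟨hx, hy⟩, rfl⟩
      refine ⟨⟨(x, y), ⟨hx.1, hy.1⟩, rfl⟩, ?_⟩
      rintro _ ⟨⟨x', y'⟩, ⟨hx', hy'⟩, rfl⟩
      rw [hm', hm']
      exact add_le_add (hx.2 _ hx') (hy.2 _ hy')
    · rintro ⟨⟨⟨x, y⟩, ⟨hx, hy⟩, rfl⟩, hz⟩
      simp only at hx hy
      refine ⟨(x, y), ⟨⟨hx, fun x' hx' => ?_⟩, ⟨hy, fun y' hy' => ?_⟩⟩, rfl⟩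
      · have := hz _ ⟨(x', y), ⟨hx', hy⟩, rfl⟩
        rw [hm', hm'] at this
        linarith
      · have := hz _ ⟨(x, y'), ⟨hx, hy'⟩, rfl⟩
        rw [hm', hm'] at this
        linarith

/-- The nonempty faces of a product are the products of nonempty faces. -/
def prodFaceMap {d e : ℕ} (P : Polytope d) (Q : Polytope e) (p : Face P × Face Q) :
    Face (P.prod Q) where
  carrier := appendEquiv d e '' (p.1.carrier ×ˢ p.2.carrier)
  nonempty := (p.1.nonempty.prod p.2.nonempty).image _
  isExposed := ((isExposed_prod_iff P.carrier Q.carrier _).2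
    ⟨_, _, ⟨p.1.nonempty, p.1.isExposed⟩, ⟨p.2.nonempty, p.2.isExposed⟩, rfl⟩).2

theorem prodFaceMap_le_iff {d e : ℕ} (P : Polytope d) (Q : Polytope e) (p q : Face P × Face Q) :
    prodFaceMap P Q p ≤ prodFaceMap P Q q ↔ p ≤ q := by
  rw [Face.le_iff, Prod.le_def, Face.le_iff, Face.le_iff, prodFaceMap, prodFaceMap,
    Set.image_subset_image_iff (appendEquiv d e).injective,
    Set.prod_subset_prod_iff' (p.1.nonempty.prod p.2.nonempty)]

/-- The face poset of a product is the product of the face posets. -/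
def prodFaceIso {d e : ℕ} (P : Polytope d) (Q : Polytope e) :
    Face P × Face Q ≃o Face (P.prod Q) :=
  OrderIso.ofSurjective (OrderEmbedding.ofMapLEIff (prodFaceMap P Q) (prodFaceMap_le_iff P Q))
    (fun G => by
      obtain ⟨F₁, F₂, h₁, h₂, hG⟩ :=
        (isExposed_prod_iff P.carrier Q.carrier G.carrier).1 ⟨G.nonempty, G.isExposed⟩
      exact ⟨(⟨F₁, h₁.1, h₁.2⟩, ⟨F₂, h₂.1, h₂.2⟩), Face.ext hG.symm⟩)

/-! ### The ring of combinatorial polytopes -/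

/-- Combinatorial types of convex polytopes. -/
def CombType : Type := Quotient combSetoid

/-- The combinatorial type of a polytope. -/
def Polytope.type {d : ℕ} (P : Polytope d) : CombType := Quotient.mk combSetoid ⟨d, P⟩

/-- The product of order isomorphisms. -/
def prodOrderIso {α β γ δ : Type} [PartialOrder α] [PartialOrder β] [PartialOrder γ]
    [PartialOrder δ] (e : α ≃o β) (f : γ ≃o δ) : α × γ ≃o β × δ where
  toEquiv := Equiv.prodCongr e.toEquiv f.toEquiv
  map_rel_iff' := by
    rintro ⟨a, c⟩ ⟨a', c'⟩
    simp [Prod.le_def]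

theorem face_point_eq (F : Face Polytope.point) : F.carrier = Set.univ :=
  Subsingleton.eq_univ_of_nonempty F.nonempty

/-- Taking the product with a point does not change the face poset. -/
def prodPointIso {d : ℕ} (P : Polytope d) : Face P × Face Polytope.point ≃o Face P where
  toFun p := p.1
  invFun F := (F, ⟨Set.univ, Set.univ_nonempty, IsExposed.refl _⟩)
  left_inv p := Prod.ext rfl (Face.ext (face_point_eq p.2).symm)
  right_inv _ := rfl
  map_rel_iff' := by
    rintro ⟨F, G⟩ ⟨F', G'⟩
    have hG : G = G' := Face.ext ((face_point_eq G).trans (face_point_eq G').symm)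
    simp [Prod.le_def, hG]

/-- Combinatorial types form a commutative monoid under the product of polytopes, with the point
as unit. -/
instance : CommMonoid CombType where
  mul := Quotient.map₂ (fun P Q => ⟨P.1 + Q.1, P.2.prod Q.2⟩) (by
    rintro P P' ⟨e⟩ Q Q' ⟨f⟩
    exact ⟨(prodFaceIso P.2 Q.2).symm.trans ((prodOrderIso e f).trans (prodFaceIso P'.2 Q'.2))⟩)
  one := Polytope.point.type
  mul_assoc := by
    rintro ⟨_, P⟩ ⟨_, Q⟩ ⟨_, R⟩
    exact Quotient.sound ⟨(prodFaceIso (P.prod Q) R).symm.trans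
      ((prodOrderIso (prodFaceIso P Q).symm (OrderIso.refl _)).trans
      ((OrderIso.prodAssoc _ _ _).trans
      ((prodOrderIso (OrderIso.refl _) (prodFaceIso Q R)).trans (prodFaceIso P (Q.prod R)))))⟩
  mul_comm := by
    rintro ⟨_, P⟩ ⟨_, Q⟩
    exact Quotient.sound ⟨(prodFaceIso P Q).symm.trans
      (OrderIso.prodComm.trans (prodFaceIso Q P))⟩
  mul_one := by
    rintro ⟨_, P⟩
    exact Quotient.sound ⟨(prodFaceIso P Polytope.point).symm.trans (prodPointIso P)⟩
  one_mul := by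
    rintro ⟨_, P⟩
    exact Quotient.sound ⟨(prodFaceIso Polytope.point P).symm.trans
      (OrderIso.prodComm.trans (prodPointIso P))⟩

/-- The ring `𝔓`: the free abelian group on the combinatorial types of convex polytopes, with the
multiplication induced by the product of polytopes; the unit is the point. -/
abbrev PolytopeRing : Type := MonoidAlgebra ℤ CombType

/-- A polytope as an element of `𝔓`. -/
def Polytope.cls {d : ℕ} (P : Polytope d) : PolytopeRing := MonoidAlgebra.of ℤ CombType P.type

/-- `F_P(t) = ∑_f f t^(codim f) ∈ 𝔓[t]`, the sum being over all nonempty faces of `P`. -/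
def Polytope.facePoly {d : ℕ} (P : Polytope d) : Polynomial PolytopeRing :=
  ∑ f : Face P, Polynomial.monomial f.codim f.toPolytope.cls

/-! ### Permutohedra -/

/-- The permutohedron `π_n` of dimension `n - 1`: the convex hull of the points of `ℝ^n` whose
coordinates are a permutation of `1, …, n`. -/
def permutohedron (n : ℕ) : Polytope n where
  carrier := convexHull ℝ (Set.range fun (σ : Equiv.Perm (Fin n)) (i : Fin n) => ((σ i : ℕ) : ℝ) + 1)
  isPolytope := by
    classical
    exact ⟨Finset.univ.image fun (σ : Equiv.Perm (Fin n)) (i : Fin n) => ((σ i : ℕ) : ℝ) + 1,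
      Finset.univ_nonempty.image _, by simp⟩

/-- `π_n` as an element of `𝔓`; here `π_1` is the point, so it is the unit of `𝔓`. -/
def perm (n : ℕ) : PolytopeRing := (permutohedron n).cls

/-- `π_n° = F_{π_n}(-π_1) = ∑_f (-π_1)^(codim f) f ∈ 𝔓`. -/
def permInterior (n : ℕ) : PolytopeRing := (permutohedron n).facePoly.eval (-perm 1)

/-! ### Permutohedra with `π_1` as an independent variable

The variable `w` of `𝔓[w, w⁻¹]` (written `T 1` below) stands for `π_1`. A face of `π_n` of
codimension `m - 1` is a product `π_{k_1} × ⋯ × π_{k_m}` with `k_1 + ⋯ + k_m = n`, and its factors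
`π_1` correspond to the coordinates of `ℝ^n` that are constant on the face. The point `π_1` is the
unit for `×`, so each of the `m - 1` signs `×` is read as multiplication followed by division by
`w`: the face is recorded as `w^(1 - m) ∏ π_{k_j}` with `w` in place of each factor `π_1`. For
instance every vertex is recorded as `w`, a face `π_1 × π_{n-1}` as `π_{n-1}` for `n ≥ 3`, and a
face `π_2 × π_2` of `π_4` as `w⁻¹ π_2²`. -/

/-- The number of coordinates that are constant on a face. -/
def Face.numConst {d : ℕ} {P : Polytope d} (F : Face P) : ℕ :=
  Nat.card {i : Fin d // ∀ x ∈ F.carrier, ∀ y ∈ F.carrier, x i = y i}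

/-- A face of a permutohedron as an element of `𝔓[w, w⁻¹]`, with `w` in the role of `π_1`. -/
def Face.weighted {n : ℕ} (F : Face (permutohedron n)) : PolytopeRing[T;T⁻¹] :=
  LaurentPolynomial.C F.toPolytope.cls * LaurentPolynomial.T ((F.numConst : ℤ) - (F.codim : ℤ))

/-- `F_{π_n}(t)`, with `w` in the role of `π_1`. -/
def weightedFacePoly (n : ℕ) : Polynomial (PolytopeRing[T;T⁻¹]) :=
  ∑ f : Face (permutohedron n), Polynomial.monomial f.codim f.weighted

/-- `π_n` for `n ≥ 1`, with `w` in the role of `π_1`. -/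
def weightedPerm (n : ℕ) : PolytopeRing[T;T⁻¹] :=
  if n = 1 then LaurentPolynomial.T 1 else LaurentPolynomial.C (perm n)

/-- `π_n° = F_{π_n}(-π_1)`, with `w` in the role of `π_1`. -/
def weightedPermInterior (n : ℕ) : PolytopeRing[T;T⁻¹] :=
  (weightedFacePoly n).eval (-weightedPerm 1)

/-- The series `∑_{n ≥ 1} a_n x^n / n!` with coefficients in `R ⊗ ℚ`. -/
def expSeries {R : Type} [CommRing R] (a : ℕ → R) : PowerSeries (ℚ ⊗[ℤ] R) :=
  PowerSeries.mk fun n => if n = 0 then 0 else ((n ! : ℚ)⁻¹) ⊗ₜ[ℤ] a n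

end Polytopal

end

noncomputable section

namespace Polytopal

/-! ### Affine images and products of polytopes -/

/-! A proper face of `π_n` has a lowest block: the nonempty proper set `S` of coordinates where a
functional defining the face is minimal. By the rearrangement inequality the face consists of a copy
of `π_|S|` in the coordinates `S` times a face `G` of `π_(n-|S|)` in the others, shifted up by
`|S|`. The face determines `S`, as the set of coordinates attaining the value `1`, and hence `G`;
every pair `(S, G)` occurs (`sum_face_eq`).

Passing from `G` to this face multiplies the class by `π_|S|` and raises the codimension by one, so
in the interior it contributes a factor `-π_1`. In `𝔓` this factor is `-1`; in the weighted version
the extra `w` is absorbed by the normalisation of faces. Hence `π_n = π_n° + ∑_S π_|S| π_(n-|S|)°`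
(`perm_eq_add_sum`, `weightedPerm_eq_add_sum`). With `p` and `q` the exponential series of `π_n` and
`π_n°`, this says `p = q + p q` (`expSeries_eq_add_mul`), that is, `(1 + p)(1 - q) = 1`. -/

theorem isExposed_image {d e : ℕ} (A : (Fin d → ℝ) ≃ᵃ[ℝ] (Fin e → ℝ)) {P F : Set (Fin d → ℝ)}
    (h : IsExposed ℝ P F) : IsExposed ℝ (A '' P) (A '' F) := by
  intro hne
  obtain ⟨l, hl⟩ := h hne.of_image
  -- Only the linear part of `A⁻¹` is used, so `l' ∘ A` differs from `l` by a constant and has the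
  -- same maximisers.
  let l' : (Fin e → ℝ) →L[ℝ] ℝ :=
    l.comp (A.symm.linear.toLinearMap.toContinuousLinearMap)
  have key : ∀ x y, l' (A x) ≤ l' (A y) ↔ l x ≤ l y := by
    intro x y
    have h1 : l' (A x) - l' (A y) = l x - l y := by
      have h2 : A x - A y = A.linear (x - y) :=
        ((A : (Fin d → ℝ) →ᵃ[ℝ] (Fin e → ℝ)).linearMap_vsub x y).symm
      rw [← map_sub l', ← map_sub l, h2]
      simp [l']
    constructor <;> intro h <;> linarith
  refine ⟨l', ?_⟩
  rw [hl]
  ext z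
  constructor
  · rintro ⟨x, ⟨hx, hx'⟩, rfl⟩
    refine ⟨⟨x, hx, rfl⟩, ?_⟩
    rintro _ ⟨y, hy, rfl⟩
    exact (key _ _).2 (hx' y hy)
  · rintro ⟨⟨x, hx, rfl⟩, h⟩
    exact ⟨x, ⟨hx, fun y hy => (key _ _).1 (h _ ⟨y, hy, rfl⟩)⟩, rfl⟩

/-- The image of a face under an affine equivalence of polytopes. -/
def Face.map {d e : ℕ} {P : Polytope d} {Q : Polytope e} (A : (Fin d → ℝ) ≃ᵃ[ℝ] (Fin e → ℝ))
    (h : Q.carrier = A '' P.carrier) (F : Face P) : Face Q where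
  carrier := A '' F.carrier
  nonempty := F.nonempty.image _
  isExposed := h ▸ isExposed_image A F.isExposed

/-- Affinely equivalent polytopes have isomorphic face posets. -/
def faceIsoOfAffineEquiv {d e : ℕ} {P : Polytope d} {Q : Polytope e}
    (A : (Fin d → ℝ) ≃ᵃ[ℝ] (Fin e → ℝ)) (h : Q.carrier = A '' P.carrier) : Face P ≃o Face Q where
  toFun := Face.map A h
  invFun := Face.map A.symm (by rw [h, ← Set.image_comp]; simp)
  left_inv F := Face.ext (by simp [Face.map, ← Set.image_comp])
  right_inv F := Face.ext (by simp only [Face.map, ← Set.image_comp]; simp)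
  map_rel_iff' {F G} := Set.image_subset_image_iff A.injective

theorem Polytope.cls_eq_of_affineEquiv {d e : ℕ} {P : Polytope d} {Q : Polytope e}
    (A : (Fin d → ℝ) ≃ᵃ[ℝ] (Fin e → ℝ)) (h : Q.carrier = A '' P.carrier) : P.cls = Q.cls :=
  congrArg (MonoidAlgebra.of ℤ CombType)
    (Quotient.sound (s := combSetoid) (a := ⟨d, P⟩) (b := ⟨e, Q⟩) ⟨faceIsoOfAffineEquiv A h⟩)

theorem Polytope.cls_prod {d e : ℕ} (P : Polytope d) (Q : Polytope e) :
    (P.prod Q).cls = P.cls * Q.cls :=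
  map_mul (MonoidAlgebra.of ℤ CombType) P.type Q.type

theorem Polytope.nonempty {d : ℕ} (P : Polytope d) : P.carrier.Nonempty := by
  obtain ⟨s, hs, h⟩ := P.isPolytope
  rw [h, convexHull_nonempty_iff]
  exact hs

theorem Polytope.dim_eq_of_affineEquiv {d e : ℕ} {P : Polytope d} {Q : Polytope e}
    (A : (Fin d → ℝ) ≃ᵃ[ℝ] (Fin e → ℝ)) (h : Q.carrier = A '' P.carrier) : P.dim = Q.dim := by
  have h1 := AffineMap.map_vectorSpan (A : (Fin d → ℝ) →ᵃ[ℝ] (Fin e → ℝ))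
    (s := P.carrier)
  rw [Polytope.dim, Polytope.dim, h]
  rw [AffineEquiv.coe_toAffineMap] at h1
  rw [← h1]
  exact (LinearEquiv.finrank_map_eq A.linear _).symm

theorem vectorSpan_prod_eq {V W : Type*} [AddCommGroup V] [Module ℝ V] [AddCommGroup W] [Module ℝ W]
    {s : Set V} {t : Set W} (hs : s.Nonempty) (ht : t.Nonempty) :
    vectorSpan ℝ (s ×ˢ t) = (vectorSpan ℝ s).prod (vectorSpan ℝ t) := by
  apply le_antisymm
  · refine Submodule.span_le.2 ?_
    rintro _ ⟨⟨x, y⟩, ⟨hx, hy⟩, ⟨x', y'⟩, ⟨hx', hy'⟩, rfl⟩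
    exact ⟨vsub_mem_vectorSpan ℝ hx hx', vsub_mem_vectorSpan ℝ hy hy'⟩
  -- Freezing one factor at a base point turns differences in the other factor into differences in
  -- the product.
  · obtain ⟨a, ha⟩ := hs
    obtain ⟨b, hb⟩ := ht
    have h1 : (vectorSpan ℝ s).map (LinearMap.inl ℝ V W) ≤ vectorSpan ℝ (s ×ˢ t) := by
      rw [vectorSpan, Submodule.map_span_le]
      rintro _ ⟨x, hx, x', hx', rfl⟩
      have := vsub_mem_vectorSpan ℝ (p₁ := (x, b)) (p₂ := (x', b)) (s := s ×ˢ t) ⟨hx, hb⟩ ⟨hx', hb⟩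
      simpa using this
    have h2 : (vectorSpan ℝ t).map (LinearMap.inr ℝ V W) ≤ vectorSpan ℝ (s ×ˢ t) := by
      rw [vectorSpan, Submodule.map_span_le]
      rintro _ ⟨x, hx, x', hx', rfl⟩
      have := vsub_mem_vectorSpan ℝ (p₁ := (a, x)) (p₂ := (a, x')) (s := s ×ˢ t) ⟨ha, hx⟩ ⟨ha, hx'⟩
      simpa using this
    rintro ⟨v, w⟩ ⟨hv, hw⟩
    have h3 := add_mem (h1 ⟨v, hv, rfl⟩) (h2 ⟨w, hw, rfl⟩)
    simpa using h3

theorem finrank_submodule_prod {V W : Type*} [AddCommGroup V] [Module ℝ V] [AddCommGroup W]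
    [Module ℝ W] [FiniteDimensional ℝ V] [FiniteDimensional ℝ W] (p : Submodule ℝ V)
    (q : Submodule ℝ W) :
    Module.finrank ℝ (p.prod q) = Module.finrank ℝ p + Module.finrank ℝ q := by
  rw [← Module.finrank_prod]
  exact LinearEquiv.finrank_eq
    { toFun := fun x => (⟨x.1.1, x.2.1⟩, ⟨x.1.2, x.2.2⟩)
      invFun := fun x => ⟨(x.1.1, x.2.1), x.1.2, x.2.2⟩
      map_add' := fun _ _ => rfl
      map_smul' := fun _ _ => rfl
      left_inv := fun _ => rfl
      right_inv := fun _ => rfl }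

theorem Polytope.dim_prod {d e : ℕ} (P : Polytope d) (Q : Polytope e) :
    (P.prod Q).dim = P.dim + Q.dim := by
  have h1 := AffineMap.map_vectorSpan
    ((appendEquiv d e).toLinearMap.toAffineMap) (s := P.carrier ×ˢ Q.carrier)
  have h2 : (P.prod Q).carrier
      = (appendEquiv d e).toLinearMap.toAffineMap '' (P.carrier ×ˢ Q.carrier) := rfl
  rw [Polytope.dim, h2, ← h1, LinearMap.toAffineMap_linear, LinearEquiv.finrank_map_eq,
    vectorSpan_prod_eq P.nonempty Q.nonempty, finrank_submodule_prod]
  rfl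

theorem Face.dim_le {d : ℕ} {P : Polytope d} (F : Face P) : F.toPolytope.dim ≤ P.dim :=
  Submodule.finrank_mono (vectorSpan_mono ℝ F.isExposed.subset)

/-- The polytope, as a face of itself. -/
instance {d : ℕ} (P : Polytope d) : OrderTop (Face P) where
  top := ⟨P.carrier, P.nonempty, IsExposed.refl _⟩
  le_top F := F.isExposed.subset

theorem Face.top_carrier {d : ℕ} (P : Polytope d) : (⊤ : Face P).carrier = P.carrier := rfl

theorem Face.top_toPolytope {d : ℕ} (P : Polytope d) : (⊤ : Face P).toPolytope = P := rfl

theorem Face.codim_top {d : ℕ} (P : Polytope d) : (⊤ : Face P).codim = 0 :=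
  Nat.sub_self _

/-! ### Vertices and faces of the permutohedron -/

/-- The vertices of the permutohedron. -/
def permVertices (n : ℕ) : Set (Fin n → ℝ) :=
  {x | ∃ f : Fin n → ℕ, Function.Injective f ∧ (∀ i, f i < n) ∧ ∀ i, x i = f i + 1}

theorem permVertices_eq_range (n : ℕ) : permVertices n =
    Set.range fun (σ : Equiv.Perm (Fin n)) (i : Fin n) => ((σ i : ℕ) : ℝ) + 1 := by
  ext x
  constructor
  · rintro ⟨f, hf, hlt, hx⟩
    have hinj : Function.Injective fun i => (⟨f i, hlt i⟩ : Fin n) := fun i j h =>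
      hf (congrArg Fin.val h)
    refine ⟨Equiv.ofBijective _ (Finite.injective_iff_bijective.1 hinj), ?_⟩
    ext i
    simp [hx]
  · rintro ⟨σ, rfl⟩
    exact ⟨fun i => σ i, fun i j h => σ.injective (Fin.ext h), fun i => (σ i).2, fun i => rfl⟩

theorem permutohedron_carrier (n : ℕ) :
    (permutohedron n).carrier = convexHull ℝ (permVertices n) := by
  rw [permVertices_eq_range]; rfl

theorem permVertices_finite (n : ℕ) : (permVertices n).Finite := by
  rw [permVertices_eq_range]; exact Set.finite_range _

theorem exists_comp_of_mem_permVertices {n : ℕ} {x y : Fin n → ℝ} (hx : x ∈ permVertices n)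
    (hy : y ∈ permVertices n) : ∃ τ : Equiv.Perm (Fin n), y = x ∘ τ := by
  rw [permVertices_eq_range] at hx hy
  obtain ⟨σ, rfl⟩ := hx
  obtain ⟨ρ, rfl⟩ := hy
  exact ⟨ρ.trans σ.symm, by ext i; simp⟩

theorem exists_mem_permVertices_monovary {n : ℕ} (c : Fin n → ℝ) :
    ∃ x ∈ permVertices n, Monovary x c := by
  rw [permVertices_eq_range]
  -- The inverse of the sorting permutation assigns to each coordinate its rank in `c`.
  refine ⟨_, ⟨(Tuple.sort c)⁻¹, rfl⟩, fun i j hij => ?_⟩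
  have hm := Tuple.monotone_sort c
  have : (Tuple.sort c)⁻¹ i ≤ (Tuple.sort c)⁻¹ j := by
    by_contra! h
    have := hm h.le
    rw [Function.comp_apply, Function.comp_apply, ← Equiv.Perm.mul_apply, ← Equiv.Perm.mul_apply,
      mul_inv_cancel] at this
    exact absurd hij (not_lt.2 this)
  simpa using this

/-- The linear functional with given coefficients. -/
def coeffFunctional {n : ℕ} (c : Fin n → ℝ) : (Fin n → ℝ) →L[ℝ] ℝ :=
  ∑ i, c i • ContinuousLinearMap.proj i

theorem coeffFunctional_apply {n : ℕ} (c x : Fin n → ℝ) :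
    coeffFunctional c x = ∑ i, x i * c i := by
  simp [coeffFunctional, mul_comm]

theorem exists_eq_coeffFunctional {n : ℕ} (l : (Fin n → ℝ) →L[ℝ] ℝ) :
    ∃ c, l = coeffFunctional c := by
  refine ⟨fun i => l (fun j => if i = j then 1 else 0), ?_⟩
  ext x
  rw [coeffFunctional_apply]
  exact LinearMap.pi_apply_eq_sum_univ (l : (Fin n → ℝ) →ₗ[ℝ] ℝ) x

/-- On vertices this is the rearrangement inequality; it extends to the convex hull because a
half-space is convex. -/
theorem coeffFunctional_le {n : ℕ} {c x y : Fin n → ℝ} (hx : x ∈ permVertices n)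
    (hc : Monovary x c) (hy : y ∈ (permutohedron n).carrier) :
    coeffFunctional c y ≤ coeffFunctional c x := by
  have h : convexHull ℝ (permVertices n) ⊆ {y | coeffFunctional c y ≤ coeffFunctional c x} := by
    refine convexHull_min ?_ (convex_halfSpace_le (coeffFunctional c).isLinear _)
    intro z hz
    obtain ⟨τ, rfl⟩ := exists_comp_of_mem_permVertices hx hz
    simp only [Set.mem_ofPred_eq, coeffFunctional_apply]
    exact hc.sum_comp_perm_mul_le_sum_mul
  rw [permutohedron_carrier] at hy
  exact h hy

theorem permVertices_subset (n : ℕ) : permVertices n ⊆ (permutohedron n).carrier := by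
  rw [permutohedron_carrier]; exact subset_convexHull ℝ _

/-- Equality case of the rearrangement inequality, comparing with a vertex sorted like `c`. -/
theorem mem_toExposed_iff_monovary {n : ℕ} {c x : Fin n → ℝ} (hx : x ∈ permVertices n) :
    x ∈ (coeffFunctional c).toExposed (permutohedron n).carrier ↔ Monovary x c := by
  constructor
  · rintro ⟨-, h⟩
    obtain ⟨y, hy, hyc⟩ := exists_mem_permVertices_monovary c
    obtain ⟨τ, rfl⟩ := exists_comp_of_mem_permVertices hy hx
    refine (hyc.sum_comp_perm_mul_eq_sum_mul_iff).1 (le_antisymm hyc.sum_comp_perm_mul_le_sum_mul ?_)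
    simpa [coeffFunctional_apply] using h y (permVertices_subset n hy)
  · exact fun h => ⟨permVertices_subset n hx, fun y hy => coeffFunctional_le hx h hy⟩

/-- The face of the permutohedron where the linear functional with given coefficients is
maximal. -/
def maxFace {n : ℕ} (c : Fin n → ℝ) : Face (permutohedron n) where
  carrier := (coeffFunctional c).toExposed (permutohedron n).carrier
  nonempty := by
    obtain ⟨y, hy, hyc⟩ := exists_mem_permVertices_monovary c
    exact ⟨y, (mem_toExposed_iff_monovary hy).2 hyc⟩
  isExposed := ContinuousLinearMap.toExposed.isExposed

theorem exists_eq_maxFace {n : ℕ} (F : Face (permutohedron n)) : ∃ c, F = maxFace c := by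
  obtain ⟨l, hl⟩ := F.isExposed F.nonempty
  obtain ⟨c, rfl⟩ := exists_eq_coeffFunctional l
  exact ⟨c, Face.ext hl⟩

theorem maxFace_carrier {n : ℕ} (c : Fin n → ℝ) :
    (maxFace c).carrier = convexHull ℝ {x ∈ permVertices n | Monovary x c} := by
  have h := (permutohedron n).face_eq_convexHull (permVertices_finite n).toFinset
    (by simpa using permutohedron_carrier n) (maxFace c)
  rw [h]
  congr 1
  ext x
  simp only [Set.Finite.coe_toFinset, Set.mem_inter_iff, Set.mem_ofPred_eq]
  exact and_congr_right fun hx => mem_toExposed_iff_monovary hx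

theorem maxFace_const {n : ℕ} (a : ℝ) : maxFace (fun _ : Fin n => a) = ⊤ := by
  apply Face.ext
  rw [maxFace_carrier, Face.top_carrier, permutohedron_carrier]
  congr 1
  ext x
  exact ⟨And.left, fun h => ⟨h, monovary_const_right x a⟩⟩

/-! ### Splitting the coordinates into two blocks -/

variable {n k m : ℕ}

/-- Splitting the coordinates of `ℝ^n` into a lower block of size `k` and an upper block, with the
values in the upper block shifted by `k`. -/
def blockEquiv (e : Fin k ⊕ Fin m ≃ Fin n) :
    (Fin n → ℝ) ≃ᵃ[ℝ] (Fin k → ℝ) × (Fin m → ℝ) :=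
  ((LinearEquiv.funCongrLeft ℝ ℝ e).trans
    (LinearEquiv.sumArrowLequivProdArrow _ _ ℝ ℝ)).toAffineEquiv.trans
    (AffineEquiv.constVAdd ℝ ((Fin k → ℝ) × (Fin m → ℝ)) (0, fun _ => -(k : ℝ)))

theorem blockEquiv_apply (e : Fin k ⊕ Fin m ≃ Fin n) (z : Fin n → ℝ) :
    blockEquiv e z = (fun i => z (e (.inl i)), fun j => z (e (.inr j)) - k) := by
  ext i
  · simp [blockEquiv, LinearMap.funLeft]
  · simp [blockEquiv, LinearMap.funLeft, sub_eq_neg_add]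

/-- The combinatorial core: since `c` is smallest exactly on the lower block, a vertex sorted like
`c` must put the values `1, …, k` there. No order is imposed inside that block, where `c` is
constant. -/
theorem mem_permVertices_and_monovary_iff (e : Fin k ⊕ Fin m ≃ Fin n) {c : Fin n → ℝ} {a : ℝ}
    (hl : ∀ i, c (e (.inl i)) = a) (hr : ∀ j, a < c (e (.inr j))) (x : Fin n → ℝ) :
    (x ∈ permVertices n ∧ Monovary x c) ↔ (blockEquiv e x).1 ∈ permVertices k ∧
      (blockEquiv e x).2 ∈ permVertices m ∧
      Monovary (blockEquiv e x).2 (fun j => c (e (.inr j))) := by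
  have hn : k + m = n := by simpa using Fintype.card_congr e
  rw [blockEquiv_apply]
  constructor
  · rintro ⟨⟨f, hf, hlt, hx⟩, hc⟩
    have hlr : ∀ i j, f (e (.inl i)) < f (e (.inr j)) := by
      intro i j
      have h1 : x (e (.inl i)) ≤ x (e (.inr j)) := hc (by rw [hl]; exact hr j)
      rw [hx, hx] at h1
      have h2 : f (e (.inl i)) ≤ f (e (.inr j)) := by exact_mod_cast (add_le_add_iff_right _).1 h1
      exact lt_of_le_of_ne h2 fun h => by simpa using e.injective (hf h)
    have hinj : Function.Injective fun i : Fin k => f (e (.inl i)) := fun i j h => by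
      simpa using e.injective (hf h)
    have hT : (Finset.univ.image fun i : Fin k => f (e (.inl i))).card = k := by
      rw [Finset.card_image_of_injective _ hinj, Finset.card_univ, Fintype.card_fin]
    have hsurj : ∀ t < n, ∃ p, f p = t := by
      intro t ht
      have hb : Function.Bijective fun i => (⟨f i, hlt i⟩ : Fin n) :=
        Finite.injective_iff_bijective.1 fun i j h => hf (congrArg Fin.val h)
      obtain ⟨p, hp⟩ := hb.2 ⟨t, ht⟩
      exact ⟨p, congrArg Fin.val hp⟩
    -- All values up to `f (e (.inl i))` are taken on the lower block, which has only `k` values.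
    have hlk : ∀ i, f (e (.inl i)) < k := by
      intro i
      have hsub : Finset.range (f (e (.inl i)) + 1) ⊆
          Finset.univ.image fun i : Fin k => f (e (.inl i)) := by
        intro t ht
        rw [Finset.mem_range, Nat.lt_succ_iff] at ht
        obtain ⟨p, rfl⟩ := hsurj t (ht.trans_lt (hlt _))
        obtain ⟨s | s, rfl⟩ := e.surjective p
        · simp
        · exact absurd (hlr i s) (not_lt.2 ht)
      have := Finset.card_le_card hsub
      rwa [hT, Finset.card_range] at this
    -- The `k` distinct values of the lower block all lie below this one.
    have hrk : ∀ j, k ≤ f (e (.inr j)) := by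
      intro j
      have hsub : (Finset.univ.image fun i : Fin k => f (e (.inl i))) ⊆
          Finset.range (f (e (.inr j))) := by
        intro t ht
        simp only [Finset.mem_image, Finset.mem_univ, true_and] at ht
        obtain ⟨i, rfl⟩ := ht
        exact Finset.mem_range.2 (hlr i j)
      have := Finset.card_le_card hsub
      rwa [hT, Finset.card_range] at this
    refine ⟨⟨_, hinj, hlk, fun i => hx _⟩, ⟨fun j => f (e (.inr j)) - k, ?_, ?_, ?_⟩, ?_⟩
    · intro i j h
      have h' : f (e (.inr i)) = f (e (.inr j)) := by
        have := hrk i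
        have := hrk j
        simp only at h
        omega
      simpa using e.injective (hf h')
    · intro j
      have := hrk j
      have := hlt (e (.inr j))
      simp only
      omega
    · intro j
      simp only [Nat.cast_sub (hrk j), hx]
      ring
    · intro i j hij
      simpa using hc hij
  · rintro ⟨⟨f, hf, hflt, hfx⟩, ⟨g, hg, hglt, hgx⟩, hc⟩
    have hxl : ∀ i, x (e (.inl i)) = f i + 1 := hfx
    have hxr : ∀ j, x (e (.inr j)) = (g j + k : ℕ) + 1 := fun j => by
      have := hgx j
      simp only at this
      push_cast
      linarith
    refine ⟨⟨fun p => Sum.elim f (fun j => g j + k) (e.symm p), ?_, ?_, ?_⟩, ?_⟩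
    · refine Function.Injective.comp (Sum.elim_injective.2 ⟨hf, fun i j h => hg (by simpa using h), ?_⟩)
        e.symm.injective
      intro i j h
      have := hflt i
      omega
    · intro p
      obtain ⟨s | s, rfl⟩ := e.surjective p
      · have := hflt s
        simp only [Equiv.symm_apply_apply, Sum.elim_inl]
        omega
      · have := hglt s
        simp only [Equiv.symm_apply_apply, Sum.elim_inr]
        omega
    · intro p
      obtain ⟨s | s, rfl⟩ := e.surjective p
      · simpa using hxl s
      · simpa using hxr s
    · intro p q hpq
      obtain ⟨s | s, rfl⟩ := e.surjective p <;> obtain ⟨t | t, rfl⟩ := e.surjective q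
      · rw [hl, hl] at hpq
        exact absurd hpq (lt_irrefl _)
      · rw [hxl, hxr]
        have := hflt s
        have : f s ≤ g t + k := by omega
        gcongr
      · rw [hl] at hpq
        exact absurd hpq (hr s).asymm
      · simpa using hc hpq

/-- The vertex statement passes to convex hulls, which commute with products and affine
equivalences. -/
theorem maxFace_carrier_eq_preimage (e : Fin k ⊕ Fin m ≃ Fin n) {c : Fin n → ℝ} {a : ℝ}
    (hl : ∀ i, c (e (.inl i)) = a) (hr : ∀ j, a < c (e (.inr j))) :
    (maxFace c).carrier = blockEquiv e ⁻¹'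
      ((permutohedron k).carrier ×ˢ (maxFace fun j => c (e (.inr j))).carrier) := by
  rw [maxFace_carrier, maxFace_carrier, permutohedron_carrier, ← convexHull_prod,
    ← AffineEquiv.image_symm]
  have h := AffineMap.image_convexHull (blockEquiv e).symm.toAffineMap
    (permVertices k ×ˢ {x ∈ permVertices m | Monovary x fun j => c (e (.inr j))})
  rw [AffineEquiv.coe_toAffineMap] at h
  rw [h, AffineEquiv.image_symm]
  congr 1
  ext x
  exact mem_permVertices_and_monovary_iff e hl hr x

theorem exists_blockFace (e : Fin k ⊕ Fin m ≃ Fin n) (G : Face (permutohedron m)) :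
    ∃ F : Face (permutohedron n), F.carrier =
      blockEquiv e ⁻¹' ((permutohedron k).carrier ×ˢ G.carrier) := by
  obtain ⟨c, rfl⟩ := exists_eq_maxFace G
  obtain ⟨b, hb⟩ := (Set.finite_range c).bddBelow
  -- As `b` is a lower bound of `c`, the constant `b - 1` makes the lower block strictly minimal.
  refine ⟨maxFace fun p => Sum.elim (fun _ => b - 1) c (e.symm p), ?_⟩
  rw [maxFace_carrier_eq_preimage e (a := b - 1) (by simp)]
  · simp
  · intro j
    have := hb ⟨j, rfl⟩
    simp only [Equiv.symm_apply_apply, Sum.elim_inr]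
    linarith

/-- The face of the permutohedron whose lowest block of coordinates is a whole permutohedron, while
the other coordinates form a given face of a smaller permutohedron. -/
def blockFace (e : Fin k ⊕ Fin m ≃ Fin n) (G : Face (permutohedron m)) : Face (permutohedron n) :=
  (exists_blockFace e G).choose

theorem blockFace_carrier (e : Fin k ⊕ Fin m ≃ Fin n) (G : Face (permutohedron m)) :
    (blockFace e G).carrier = blockEquiv e ⁻¹' ((permutohedron k).carrier ×ˢ G.carrier) :=
  (exists_blockFace e G).choose_spec

theorem prod_carrier_eq_image_blockFace (e : Fin k ⊕ Fin m ≃ Fin n) (G : Face (permutohedron m)) :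
    ((permutohedron k).prod G.toPolytope).carrier =
      (blockEquiv e).trans (appendEquiv k m).toAffineEquiv ''
        (blockFace e G).toPolytope.carrier := by
  have h : (blockFace e G).toPolytope.carrier = (blockFace e G).carrier := rfl
  rw [h, blockFace_carrier, AffineEquiv.coe_trans, Set.image_comp,
    Set.image_preimage_eq _ (blockEquiv e).surjective]
  rfl

theorem blockFace_cls (e : Fin k ⊕ Fin m ≃ Fin n) (G : Face (permutohedron m)) :
    (blockFace e G).toPolytope.cls = perm k * G.toPolytope.cls := by
  rw [Polytope.cls_eq_of_affineEquiv _ (prod_carrier_eq_image_blockFace e G), Polytope.cls_prod]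
  rfl

theorem blockFace_dim (e : Fin k ⊕ Fin m ≃ Fin n) (G : Face (permutohedron m)) :
    (blockFace e G).toPolytope.dim = (permutohedron k).dim + G.toPolytope.dim := by
  rw [Polytope.dim_eq_of_affineEquiv _ (prod_carrier_eq_image_blockFace e G), Polytope.dim_prod]

theorem blockFace_numConst (e : Fin k ⊕ Fin m ≃ Fin n) (G : Face (permutohedron m)) :
    (blockFace e G).numConst = (⊤ : Face (permutohedron k)).numConst + G.numConst := by
  rw [Face.numConst, Face.numConst, Face.numConst, ← Nat.card_sum]
  refine Nat.card_congr ((e.subtypeEquiv fun _ => Iff.rfl).symm.trans (Equiv.subtypeSum.trans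
    (Equiv.sumCongr (Equiv.subtypeEquivRight fun i => ?_) (Equiv.subtypeEquivRight fun j => ?_))))
  -- The blocks vary independently, so constancy in one is tested with a fixed point in the other.
  · obtain ⟨y, hy⟩ := G.nonempty
    rw [blockFace_carrier]
    constructor
    · intro h x hx x' hx'
      have := h ((blockEquiv e).symm (x, y)) (by simpa using ⟨hx, hy⟩)
        ((blockEquiv e).symm (x', y)) (by simpa using ⟨hx', hy⟩)
      have h1 := congrArg Prod.fst (blockEquiv_apply e ((blockEquiv e).symm (x, y)))
      have h2 := congrArg Prod.fst (blockEquiv_apply e ((blockEquiv e).symm (x', y)))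
      rw [AffineEquiv.apply_symm_apply] at h1 h2
      simp only at h1 h2
      rw [h1, h2]
      exact this
    · intro h z hz z' hz'
      rw [Set.mem_preimage, blockEquiv_apply] at hz hz'
      exact h _ hz.1 _ hz'.1
  · obtain ⟨x, hx⟩ := (permutohedron k).nonempty
    rw [blockFace_carrier]
    constructor
    · intro h y hy y' hy'
      have := h ((blockEquiv e).symm (x, y)) (by simpa using ⟨hx, hy⟩)
        ((blockEquiv e).symm (x, y')) (by simpa using ⟨hx, hy'⟩)
      have h1 := congrArg Prod.snd (blockEquiv_apply e ((blockEquiv e).symm (x, y)))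
      have h2 := congrArg Prod.snd (blockEquiv_apply e ((blockEquiv e).symm (x, y')))
      rw [AffineEquiv.apply_symm_apply] at h1 h2
      simp only at h1 h2
      rw [h1, h2]
      simpa using this
    · intro h z hz z' hz'
      rw [Set.mem_preimage, blockEquiv_apply] at hz hz'
      simpa using h _ hz.2 _ hz'.2

theorem blockFace_injective (e : Fin k ⊕ Fin m ≃ Fin n) : Function.Injective (blockFace e) := by
  intro G G' h
  have h1 := congrArg Face.carrier h
  rw [blockFace_carrier, blockFace_carrier] at h1
  have h2 := (Set.preimage_injective.2 (blockEquiv e).surjective) h1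
  apply Face.ext
  obtain ⟨x, hx⟩ := (permutohedron k).nonempty
  ext y
  have h3 := Set.ext_iff.1 h2 (x, y)
  simpa [hx] using h3

theorem one_le_of_mem {x : Fin n → ℝ} (hx : x ∈ (permutohedron n).carrier) (i : Fin n) :
    1 ≤ x i := by
  rw [permutohedron_carrier] at hx
  have h : convexHull ℝ (permVertices n) ⊆ {y | 1 ≤ y i} := by
    refine convexHull_min ?_
      (convex_halfSpace_ge (LinearMap.proj i : (Fin n → ℝ) →ₗ[ℝ] ℝ).isLinear _)
    rintro z ⟨f, -, -, hz⟩
    simp [hz]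
  exact h hx

theorem exists_mem_eq_one (i : Fin n) : ∃ x ∈ (permutohedron n).carrier, x i = 1 := by
  have hn : 0 < n := i.pos
  refine ⟨_, permVertices_subset n ⟨fun j => Equiv.swap i ⟨0, hn⟩ j, fun a b h => ?_, fun a => ?_,
    fun _ => rfl⟩, ?_⟩
  · exact (Equiv.swap i ⟨0, hn⟩).injective (Fin.ext h)
  · exact (Equiv.swap i ⟨0, hn⟩ a).2
  · simp

/-- The lowest block of a face consists of the coordinates that attain the value `1`. -/
theorem mem_block_iff (hk : 0 < k) (e : Fin k ⊕ Fin m ≃ Fin n) (G : Face (permutohedron m))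
    (i : Fin n) :
    (∃ x ∈ (blockFace e G).carrier, x i = 1) ↔ ∃ s, i = e (.inl s) := by
  rw [blockFace_carrier]
  obtain ⟨s | s, rfl⟩ := e.surjective i
  · obtain ⟨x, hx, hxs⟩ := exists_mem_eq_one s
    obtain ⟨y, hy⟩ := G.nonempty
    refine iff_of_true ⟨(blockEquiv e).symm (x, y), by simpa using ⟨hx, hy⟩, ?_⟩ ⟨s, rfl⟩
    have h1 := congrArg Prod.fst (blockEquiv_apply e ((blockEquiv e).symm (x, y)))
    rw [AffineEquiv.apply_symm_apply] at h1
    rw [← hxs]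
    exact (congrFun h1 s).symm
  · refine iff_of_false ?_ (by simp)
    rintro ⟨x, hx, hxs⟩
    rw [Set.mem_preimage, blockEquiv_apply] at hx
    have h1 := one_le_of_mem (G.isExposed.subset hx.2) s
    have : (0 : ℝ) < k := by exact_mod_cast hk
    simp only at h1
    linarith

/-- On the whole permutohedron every coordinate attains `1`; here those of the upper block do not.
-/
theorem blockFace_ne_top (hk : 0 < k) (hm : 0 < m) (e : Fin k ⊕ Fin m ≃ Fin n)
    (G : Face (permutohedron m)) : blockFace e G ≠ ⊤ := by
  intro h
  have h1 := mem_block_iff hk e G (e (.inr ⟨0, hm⟩))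
  rw [h, Face.top_carrier] at h1
  simpa using h1.1 (exists_mem_eq_one _)

/-! ### Dimension and constant coordinates of the permutohedron -/

/-- The functional with all coefficients `1` has the whole permutohedron as its maximal face. -/
theorem sum_eq_of_mem {x y : Fin n → ℝ} (hx : x ∈ (permutohedron n).carrier)
    (hy : y ∈ (permutohedron n).carrier) : ∑ i, x i = ∑ i, y i := by
  have h : ∀ {x y : Fin n → ℝ}, x ∈ (permutohedron n).carrier → y ∈ (permutohedron n).carrier →
      ∑ i, y i ≤ ∑ i, x i := by
    intro x y hx hy
    rw [← Face.top_carrier, ← maxFace_const 1] at hx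
    simpa [coeffFunctional_apply] using hx.2 y hy
  exact le_antisymm (h hy hx) (h hx hy)

theorem exists_mem_swap_mem (n : ℕ) : ∃ x ∈ (permutohedron n).carrier, Function.Injective x ∧
    ∀ i j, x ∘ Equiv.swap i j ∈ (permutohedron n).carrier := by
  refine ⟨fun i => (i : ℕ) + 1,
    permVertices_subset n ⟨fun i => i, Fin.val_injective, Fin.is_lt, fun i => rfl⟩,
    fun i j h => by simpa [Fin.ext_iff] using h, fun i j => permVertices_subset n
    ⟨fun a => Equiv.swap i j a, Fin.val_injective.comp (Equiv.swap i j).injective,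
      fun a => Fin.is_lt _, fun a => rfl⟩⟩

theorem single_sub_single_mem (i j : Fin n) :
    (Pi.single i 1 - Pi.single j 1 : Fin n → ℝ) ∈ vectorSpan ℝ (permutohedron n).carrier := by
  obtain rfl | hij := eq_or_ne i j
  · simp
  obtain ⟨x, hx, hinj, hs⟩ := exists_mem_swap_mem n
  have h1 := vsub_mem_vectorSpan ℝ hx (hs i j)
  have h2 : x i - x j ≠ 0 := sub_ne_zero.2 fun h => hij (hinj h)
  -- Swapping two coordinates of a vertex moves it along a nonzero multiple of `e_i - e_j`.
  have h3 : x -ᵥ x ∘ Equiv.swap i j = (x i - x j) • (Pi.single i 1 - Pi.single j 1) := by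
    ext a
    rcases eq_or_ne a i with rfl | hai
    · simp [hij]
    rcases eq_or_ne a j with rfl | haj
    · simp [hai]
    · simp [hai, haj, Equiv.swap_apply_of_ne_of_ne hai haj]
  rw [h3] at h1
  exact (Submodule.smul_mem_iff _ h2).1 h1

/-- The constant coordinate sum bounds the dimension above; below, the vectors `e_i - e_j` together
with one basis vector span `ℝ^n`. -/
theorem dim_permutohedron (hn : 0 < n) : (permutohedron n).dim + 1 = n := by
  apply le_antisymm
  · have hle : vectorSpan ℝ (permutohedron n).carrier ≤
        LinearMap.ker (coeffFunctional (fun _ : Fin n => 1) : (Fin n → ℝ) →ₗ[ℝ] ℝ) := by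
      refine Submodule.span_le.2 ?_
      rintro _ ⟨x, hx, y, hy, rfl⟩
      simp [coeffFunctional_apply, sum_eq_of_mem hx hy]
    have hlt : vectorSpan ℝ (permutohedron n).carrier < ⊤ := by
      refine lt_top_iff_ne_top.2 fun h => ?_
      have h1 : (Pi.single ⟨0, hn⟩ 1 : Fin n → ℝ) ∈
          vectorSpan ℝ (permutohedron n).carrier := h ▸ Submodule.mem_top
      simpa [coeffFunctional_apply] using hle h1
    simpa [Polytope.dim] using Submodule.finrank_lt hlt.ne
  · have htop : vectorSpan ℝ (permutohedron n).carrier ⊔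
        Submodule.span ℝ {(Pi.single ⟨0, hn⟩ 1 : Fin n → ℝ)} = ⊤ := by
      rw [eq_top_iff, ← (Pi.basisFun ℝ (Fin n)).span_eq, Submodule.span_le]
      rintro _ ⟨i, rfl⟩
      have := Submodule.add_mem_sup (single_sub_single_mem i ⟨0, hn⟩)
        (Submodule.mem_span_singleton_self (R := ℝ) (Pi.single ⟨0, hn⟩ 1 : Fin n → ℝ))
      simpa using this
    have h1 := Submodule.finrank_add_le_finrank_add_finrank
      (vectorSpan ℝ (permutohedron n).carrier)
      (Submodule.span ℝ {(Pi.single ⟨0, hn⟩ 1 : Fin n → ℝ)})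
    rw [htop, finrank_top, Module.finrank_fin_fun] at h1
    exact h1.trans (Nat.add_le_add_left ((finrank_span_le_card _).trans (by simp)) _)

theorem permutohedron_one_subsingleton : (permutohedron 1).carrier.Subsingleton := by
  intro x hx y hy
  ext i
  have := sum_eq_of_mem hx hy
  rw [Subsingleton.elim i 0]
  simpa using this

theorem numConst_top (hn : 0 < n) :
    (⊤ : Face (permutohedron n)).numConst = if n = 1 then 1 else 0 := by
  split_ifs with h
  · subst h
    rw [Face.numConst, Nat.card_eq_one_iff_unique]
    refine ⟨inferInstance, ⟨0, fun x hx y hy => ?_⟩⟩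
    rw [permutohedron_one_subsingleton hx hy]
  · have : Nontrivial (Fin n) := Fin.nontrivial_iff_two_le.2 (by omega)
    rw [Face.numConst, Nat.card_eq_zero]
    refine .inl ⟨fun ⟨i, hi⟩ => ?_⟩
    obtain ⟨x, hx, hinj, hs⟩ := exists_mem_swap_mem n
    obtain ⟨j, hj⟩ := exists_ne i
    have := hi x hx _ (hs i j)
    rw [Function.comp_apply, Equiv.swap_apply_left] at this
    exact hj (hinj this).symm

theorem perm_one : perm 1 = 1 := by
  have h1 : ∀ F : Face (permutohedron 1), F = ⊤ := fun F =>
    le_antisymm le_top fun x hx => by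
      obtain ⟨y, hy⟩ := F.nonempty
      rwa [permutohedron_one_subsingleton hx (F.isExposed.subset hy)]
  have h2 : ∀ F : Face Polytope.point, F = ⊤ := fun F =>
    Face.ext ((face_point_eq F).trans (face_point_eq ⊤).symm)
  have e : Face (permutohedron 1) ≃o Face Polytope.point :=
    { toFun := fun _ => ⊤
      invFun := fun _ => ⊤
      left_inv := fun F => (h1 F).symm
      right_inv := fun F => (h2 F).symm
      map_rel_iff' := fun {F G} => by rw [h1 F, h1 G]; simp }
  exact (congrArg (MonoidAlgebra.of ℤ CombType) (Quotient.sound (s := combSetoid)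
    (a := ⟨1, permutohedron 1⟩) (b := ⟨0, Polytope.point⟩) ⟨e⟩)).trans (map_one _)

/-- Dimensions add, and `(k - 1) + (m - 1)` is one less than `n - 1`. The bound `G.dim_le` makes the
truncated subtraction harmless. -/
theorem blockFace_codim (hk : 0 < k) (hm : 0 < m) (e : Fin k ⊕ Fin m ≃ Fin n)
    (G : Face (permutohedron m)) : (blockFace e G).codim = G.codim + 1 := by
  have hn : k + m = n := by simpa using Fintype.card_congr e
  have h1 := dim_permutohedron hk
  have h2 := dim_permutohedron hm
  have h3 := dim_permutohedron (n := n) (by omega)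
  have h4 := G.dim_le
  rw [Face.codim, Face.codim, blockFace_dim]
  omega

/-! ### Sums over the faces of the permutohedron -/

/-- The coordinates in a set `S`, followed by the other coordinates. -/
abbrev blockSplit (S : Finset (Fin n)) : Fin S.card ⊕ Fin Sᶜ.card ≃ Fin n :=
  finSumEquivOfFinset rfl rfl

theorem exists_eq_blockSplit_inl {S : Finset (Fin n)} {i : Fin n} :
    (∃ s, i = blockSplit S (.inl s)) ↔ i ∈ S := by
  simp_rw [blockSplit, finSumEquivOfFinset_inl]
  rw [← Finset.mem_coe, ← Finset.range_orderEmbOfFin S rfl, Set.mem_range]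
  exact exists_congr fun _ => eq_comm

/-- The sets of coordinates that are the lowest block of a proper face. -/
def properBlocks (n : ℕ) : Finset (Finset (Fin n)) :=
  Finset.univ.filter fun S => S.Nonempty ∧ Sᶜ.Nonempty

theorem mem_properBlocks {S : Finset (Fin n)} :
    S ∈ properBlocks n ↔ 0 < S.card ∧ 0 < Sᶜ.card := by
  simp [properBlocks]

theorem exists_eq_blockFace {F : Face (permutohedron n)} (hF : F ≠ ⊤) :
    ∃ S ∈ properBlocks n, ∃ G, F = blockFace (blockSplit S) G := by
  obtain ⟨c, rfl⟩ := exists_eq_maxFace F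
  obtain hn | hn := isEmpty_or_nonempty (Fin n)
  · rw [Subsingleton.elim c fun _ => 0, maxFace_const] at hF
    exact absurd rfl hF
  obtain ⟨i₀, hi₀⟩ := Finite.exists_min c
  -- The minimum locus of `c`. It is not everything, since a constant functional defines the top
  -- face.
  let S : Finset (Fin n) := {i | c i = c i₀}
  have hS : ∀ i, i ∈ S ↔ c i = c i₀ := by simp [S]
  refine ⟨S, mem_properBlocks.2 ⟨Finset.card_pos.2 ⟨i₀, (hS _).2 rfl⟩, Finset.card_pos.2 ?_⟩,
    maxFace fun j => c (blockSplit S (.inr j)), ?_⟩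
  · by_contra h
    rw [Finset.not_nonempty_iff_eq_empty, Finset.compl_eq_empty_iff] at h
    have hc : c = fun _ => c i₀ := funext fun i => (hS i).1 (h ▸ Finset.mem_univ i)
    rw [hc, maxFace_const] at hF
    exact hF rfl
  · apply Face.ext
    rw [blockFace_carrier]
    refine maxFace_carrier_eq_preimage _ (a := c i₀) (fun i => (hS _).1 ?_) fun j => ?_
    · exact exists_eq_blockSplit_inl.1 ⟨i, rfl⟩
    · refine lt_of_le_of_ne (hi₀ _) fun h => ?_
      obtain ⟨s, hs⟩ := exists_eq_blockSplit_inl.2 ((hS _).2 h.symm)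
      exact Sum.inr_ne_inl ((blockSplit S).injective hs)

theorem sum_face_eq {M : Type*} [AddCommMonoid M] (v : Face (permutohedron n) → M) :
    ∑ F, v F = v ⊤ + ∑ S ∈ properBlocks n, ∑ G : Face (permutohedron Sᶜ.card),
      v (blockFace (blockSplit S) G) := by
  classical
  rw [← Finset.add_sum_erase _ _ (Finset.mem_univ (⊤ : Face (permutohedron n))), Finset.sum_sigma']
  congr 1
  symm
  refine Finset.sum_bij (fun p _ => blockFace (blockSplit p.1) p.2) ?_ ?_ ?_ fun _ _ => rfl
  · rintro ⟨S, G⟩ h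
    obtain ⟨h1, h2⟩ := mem_properBlocks.1 (Finset.mem_sigma.1 h).1
    exact Finset.mem_erase.2 ⟨blockFace_ne_top h1 h2 _ _, Finset.mem_univ _⟩
  · rintro ⟨S, G⟩ h ⟨S', G'⟩ h' heq
    have h1 := (mem_properBlocks.1 (Finset.mem_sigma.1 h).1).1
    have h1' := (mem_properBlocks.1 (Finset.mem_sigma.1 h').1).1
    simp only at heq
    -- The face remembers `S` as the set of coordinates that attain `1`.
    obtain rfl : S = S' := by
      ext i
      rw [← exists_eq_blockSplit_inl, ← exists_eq_blockSplit_inl, ← mem_block_iff h1 _ G,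
        ← mem_block_iff h1' _ G', heq]
    rw [blockFace_injective _ heq]
  · intro F hF
    obtain ⟨S, hS, G, rfl⟩ := exists_eq_blockFace (Finset.mem_erase.1 hF).1
    exact ⟨⟨S, G⟩, Finset.mem_sigma.2 ⟨hS, Finset.mem_univ _⟩, rfl⟩

/-! ### Recursions for the interiors -/

theorem permInterior_eq_sum (n : ℕ) : permInterior n =
    ∑ F : Face (permutohedron n), F.toPolytope.cls * (-perm 1) ^ F.codim := by
  simp [permInterior, Polytope.facePoly, Polynomial.eval_finsetSum]

theorem weightedPermInterior_eq_sum (n : ℕ) : weightedPermInterior n =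
    ∑ F : Face (permutohedron n), F.weighted * (-weightedPerm 1) ^ F.codim := by
  simp [weightedPermInterior, weightedFacePoly, Polynomial.eval_finsetSum]

/-- The top face gives `π_n`. Every proper face cancels against its term in the sum over `S`,
because its extra codimension contributes `-π_1 = -1`. -/
theorem perm_eq_add_sum (n : ℕ) : perm n = permInterior n +
    ∑ S ∈ properBlocks n, perm S.card * permInterior Sᶜ.card := by
  rw [permInterior_eq_sum, sum_face_eq, add_assoc, ← Finset.sum_add_distrib,
    Finset.sum_eq_zero, add_zero, Face.codim_top, Face.top_toPolytope, pow_zero, mul_one, perm]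
  intro S hS
  obtain ⟨h1, h2⟩ := mem_properBlocks.1 hS
  rw [permInterior_eq_sum, Finset.mul_sum, ← Finset.sum_add_distrib]
  refine Finset.sum_eq_zero fun G _ => ?_
  rw [blockFace_cls, blockFace_codim h1 h2, perm_one]
  ring

theorem weighted_top (hn : 0 < n) :
    (⊤ : Face (permutohedron n)).weighted = weightedPerm n := by
  rw [Face.weighted, numConst_top hn, Face.codim_top, Face.top_toPolytope, weightedPerm]
  split_ifs with h
  · subst h
    have : (permutohedron 1).cls = 1 := perm_one
    simp [this]
  · simp [perm]

/-- Constant coordinates add over the blocks while the codimension grows by one, so the recorded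
power of `w` drops by one. This cancels the `w` in the additional factor `-w` and leaves only the
sign. -/
theorem blockFace_weighted (hk : 0 < k) (hm : 0 < m) (e : Fin k ⊕ Fin m ≃ Fin n)
    (G : Face (permutohedron m)) : (blockFace e G).weighted * (-weightedPerm 1) ^ (blockFace e G).codim
      = -(weightedPerm k * (G.weighted * (-weightedPerm 1) ^ G.codim)) := by
  have h1 : weightedPerm 1 = LaurentPolynomial.T 1 := if_pos rfl
  have h2 : (((blockFace e G).numConst : ℤ) - (blockFace e G).codim) + 1 =
      (((⊤ : Face (permutohedron k)).numConst : ℤ) - (⊤ : Face (permutohedron k)).codim) +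
        ((G.numConst : ℤ) - G.codim) := by
    rw [blockFace_numConst, blockFace_codim hk hm, Face.codim_top]
    push_cast
    ring
  have h3 := congrArg (LaurentPolynomial.T (R := PolytopeRing)) h2
  rw [LaurentPolynomial.T_add, LaurentPolynomial.T_add] at h3
  rw [← weighted_top hk, blockFace_codim hk hm, pow_succ, h1, Face.weighted, blockFace_cls, map_mul,
    Face.weighted, Face.weighted, Face.top_toPolytope, perm]
  linear_combination (-(LaurentPolynomial.C (permutohedron k).cls *
    LaurentPolynomial.C G.toPolytope.cls * (-LaurentPolynomial.T 1) ^ G.codim)) * h3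

theorem weightedPerm_eq_add_sum (hn : 0 < n) : weightedPerm n = weightedPermInterior n +
    ∑ S ∈ properBlocks n, weightedPerm S.card * weightedPermInterior Sᶜ.card := by
  rw [weightedPermInterior_eq_sum, sum_face_eq, add_assoc, ← Finset.sum_add_distrib,
    Finset.sum_eq_zero, add_zero, weighted_top hn, Face.codim_top, pow_zero, mul_one]
  intro S hS
  obtain ⟨h1, h2⟩ := mem_properBlocks.1 hS
  rw [weightedPermInterior_eq_sum, Finset.mul_sum, ← Finset.sum_add_distrib]
  refine Finset.sum_eq_zero fun G _ => ?_
  rw [blockFace_weighted h1 h2]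
  ring

/-! ### Exponential series -/

theorem expSeries_eq_add_mul {R : Type} [CommRing R] {p q : ℕ → R}
    (h : ∀ n, 0 < n → p n = q n + ∑ S ∈ properBlocks n, p S.card * q Sᶜ.card) :
    expSeries p = expSeries q + expSeries p * expSeries q := by
  ext n
  rw [map_add, PowerSeries.coeff_mul]
  obtain rfl | hn := Nat.eq_zero_or_pos n
  · simp [expSeries]
  have hsum : ∑ S ∈ properBlocks n, ((n ! : ℚ)⁻¹) ⊗ₜ[ℤ] (p S.card * q Sᶜ.card) =
      ∑ x ∈ Finset.HasAntidiagonal.antidiagonal n, PowerSeries.coeff x.1 (expSeries p) *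
        PowerSeries.coeff x.2 (expSeries q) := by
    rw [Finset.Nat.sum_antidiagonal_eq_sum_range_succ
      (fun i j => PowerSeries.coeff i (expSeries p) * PowerSeries.coeff j (expSeries q))]
    -- The summand depends only on `i = |S|`. Setting it to zero for `S` empty or full matches the
    -- zero constant term of `expSeries`.
    let f : ℕ → ℚ ⊗[ℤ] R := fun i =>
      if 0 < i ∧ 0 < n - i then ((n ! : ℚ)⁻¹) ⊗ₜ[ℤ] (p i * q (n - i)) else 0
    have h1 := Finset.sum_powerset_apply_card f (x := (Finset.univ : Finset (Fin n)))
    rw [Finset.powerset_univ, Finset.card_univ, Fintype.card_fin] at h1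
    calc _ = ∑ S : Finset (Fin n), f S.card := by
          rw [properBlocks, Finset.sum_filter]
          refine Finset.sum_congr rfl fun S _ => ?_
          simp only [f, ← Finset.card_pos, Finset.card_compl, Fintype.card_fin]
      _ = _ := h1
      _ = _ := by
          refine Finset.sum_congr rfl fun i hi => ?_
          have hin : i ≤ n := Nat.lt_succ_iff.1 (Finset.mem_range.1 hi)
          simp only [f, expSeries, PowerSeries.coeff_mk]
          by_cases hi0 : i = 0
          · simp [hi0]
          by_cases hj0 : n - i = 0
          · simp [hj0]
          rw [if_pos ⟨Nat.pos_of_ne_zero hi0, Nat.pos_of_ne_zero hj0⟩, if_neg hi0, if_neg hj0,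
            Algebra.TensorProduct.tmul_mul_tmul, TensorProduct.smul_tmul']
          congr 1
          -- There are `n.choose i` sets of size `i`, and `n.choose i / n! = 1 / (i! (n - i)!)`.
          rw [nsmul_eq_mul, Nat.cast_choose ℚ hin]
          have := Nat.factorial_ne_zero n
          have := Nat.factorial_ne_zero i
          have := Nat.factorial_ne_zero (n - i)
          field_simp
  rw [← hsum, ← TensorProduct.tmul_sum]
  simp only [expSeries, PowerSeries.coeff_mk, if_neg hn.ne']
  rw [← TensorProduct.tmul_add, ← h n hn]

theorem one_add_expSeries_mul_one_sub {R : Type} [CommRing R] {p q : ℕ → R}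
    (h : ∀ n, 0 < n → p n = q n + ∑ S ∈ properBlocks n, p S.card * q Sᶜ.card) :
    (1 + expSeries p) * (1 - expSeries q) = 1 := by
  linear_combination expSeries_eq_add_mul h

end Polytopal

end

theorem theorem3p5 :
    (1 + Polytopal.expSeries Polytopal.perm) * (1 - Polytopal.expSeries Polytopal.permInterior) = 1 ∧
    (1 + Polytopal.expSeries Polytopal.weightedPerm) *
      (1 - Polytopal.expSeries Polytopal.weightedPermInterior) = 1 :=
  ⟨Polytopal.one_add_expSeries_mul_one_sub fun n _ => Polytopal.perm_eq_add_sum n,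
    Polytopal.one_add_expSeries_mul_one_sub fun _ hn => Polytopal.weightedPerm_eq_add_sum hn⟩
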